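/- Conventions. $L_0$ is a relational signature and $L=L_0\cup\{<\}$ with a new binary relation symbol $<$; $B\le A$ means that $B$ is a substructure of $A$. For an $L_0$-structure $A$ and a linear ordering $\prec$ of $A$, $(A,\prec)$ is the $L$-structure that expands $A$ by $\prec$. For a class $\mathcal K_<$ of $L$-structures in which $<$ is interpreted as a linear ordering, $\mathcal K=\mathcal K_<|L_0$ is the class of the $L_0$-reducts of its members. $\mathrm{Age}(M)$ is the class of all finitely generated structures that embed into $M$. $\mathcal K_<$ is a *Jónsson class* for an ordinal $\alpha>0$ if: (I) for every ordinal $\xi$ it has a member of cardinality at least $\aleph_\xi$; (II) it is closed under isomorphism; (III) it has the joint embedding property; (IV) it has the amalgamation property; (V) it is closed under unions of nonempty well-ordered chains $\langle A_\xi:\xi<\lambda\rangle$ with $A_\xi\le A_\nu$ for $\xi<\nu<\lambda$; (VI) if $A\in\mathcal K_<$, $B\le A$ and $|B|<\aleph_\alpha$, then there is $C\in\mathcal K_<$ with $B\le C\le A$ and $|C|<\aleph_\alpha$. It is *reasonable* if, whenever $A\le B$ are in $\mathcal K$ and $\prec$ is a linear ordering of $A$ with $(A,\prec)\in\mathcal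 K_<$, there is a linear ordering $\prec'$ of $B$ with $(B,\prec')\in\mathcal K_<$ and $(A,\prec)\le(B,\prec')$. A structure $M\in\mathcal K_<$ of cardinality $\aleph_\alpha$ is *$(\aleph_\alpha,\mathcal K_<)$-universal homogeneous* if every $B\in\mathcal K_<$ with $|B|\le\aleph_\alpha$ embeds into $M$, and for every $B\le M$ with $B\in\mathcal K_<$ and $|B|<\aleph_\alpha$ every embedding of $B$ into $M$ extends to an automorphism of $M$. A class $\mathcal C$ of structures has the *Ramsey property* if for all $A,B\in\mathcal C$ such that $A$ embeds into $B$ and all natural numbers $k\ge2$ there is $C\in\mathcal C$ such that for every colouring with $k$ colours of the substructures of $C$ isomorphic to $A$ there is a substructure $B'\cong B$ of $C$ such that all substructures of $B'$ isomorphic to $A$ have the same colour. A class $\mathcal C_<$ of $L$-structures in which $<$ is interpreted as a linear ordering has the *ordering property* if for every $A\in\mathcal C_<|L_0$ there is $B\in\mathcal C_<|L_0$ such that $(A,\prec)$ embeds into $(B,\prec')$ for all linear orderings $\prec$ of $A$ and $\prec'$ of $B$ with $(A,\prec),(B,\prec')\in\mathcal C_<$. Automorphism groups carry the topology of pointwise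 convergence on the discrete underlying set, and their subgroups the subspace topology. For a topological group $G$, a *$G$-flow* is a nonempty compact Hausdorff space with a continuous action of $G$; it is *minimal* if all its orbits are dense. A *universal minimal flow* of $G$ is a minimal $G$-flow that maps onto every minimal $G$-flow by a continuous $G$-equivariant map. $G$ is *extremely amenable* if its universal minimal flow is a single point. $\mathrm{LO}(A)$ is the space of (strict) linear orderings of $A$ with the topology inherited from $2^{A\times A}$; $\mathrm{Aut}(A)$ acts on it by $a\,(g{\prec})\,b\iff g^{-1}a\prec g^{-1}b$. **Theorem.** Let $\alpha>0$ be an ordinal with $\aleph_\alpha^{<\aleph_\alpha}=\aleph_\alpha$. Let $\mathcal K_<$ be a reasonable Jónsson class for $\alpha$ of $L$-structures in which $<$ is interpreted as a linear ordering, and suppose that $\mathcal K_<$ is closed under substructures. Let $(A,<)$ be an $(\aleph_\alpha,\mathcal K_<)$-universal homogeneous structure, and let $A=(A,<)|L_0$ be its reduct. (a) If $\mathrm{Age}(A,<)$ has the Ramsey property, then every dense subgroup $G_<$ of $\mathrm{Aut}(A,<)$ is extremely amenable. (b) If $\mathrm{Age}(A,<)$ has both the Ramsey property and the ordering property, then for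 every dense subgroup $G$ of $\mathrm{Aut}(A)$ the universal minimal flow of $G$ is $\overline{G{<}}$, the closure in $\mathrm{LO}(A)$ of the orbit of $<$ under $G$. -/

import Mathlib

universe u v w x y z

open FirstOrder CategoryTheory Cardinal

namespace JonssonFlows

noncomputable section

/-! ### Automorphism groups with the topology of pointwise convergence -/

section Aut

variable {L : FirstOrder.Language.{u, v}} {A : Type w} [L.Structure A]

instance autGroup : Group (A ≃[L] A) where
  mul f g := f.comp g
  one := FirstOrder.Language.Equiv.refl L A
  inv f := f.symm
  mul_assoc _ _ _ := rfl
  one_mul _ := rfl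
  mul_one _ := rfl
  inv_mul_cancel f := FirstOrder.Language.Equiv.ext fun a => f.symm_apply_apply a

/-- Pointwise convergence, where `A` is a discrete space. -/
instance autTopology : TopologicalSpace (A ≃[L] A) :=
  TopologicalSpace.induced (fun (g : A ≃[L] A) (a : A) => g a)
    (@Pi.topologicalSpace A (fun _ => A) (fun _ => ⊥))

end Aut

/-! ### Flows -/

section Flows

/-- A minimal `G`-flow: a nonempty compact Hausdorff space with a continuous action of `G` all of
whose orbits are dense. -/
structure IsMinimalFlow (G : Type x) [Group G] [TopologicalSpace G]
    (X : Type y) [TopologicalSpace X] [MulAction G X] : Prop where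
  compact : CompactSpace X
  hausdorff : T2Space X
  nonempty : Nonempty X
  continuous_action : ContinuousSMul G X
  minimal : MulAction.IsMinimal G X

/-- `X` is the universal minimal flow of `G`: it is a minimal `G`-flow that maps onto every minimal
`G`-flow `Y` (in a given universe) by a continuous `G`-equivariant map. -/
structure IsUniversalMinimalFlow (G : Type x) [Group G] [TopologicalSpace G]
    (X : Type y) [TopologicalSpace X] [MulAction G X] : Prop where
  isMinimalFlow : IsMinimalFlow G X
  universal : ∀ (Y : Type z) [TopologicalSpace Y] [MulAction G Y], IsMinimalFlow G Y →
    ∃ f : X → Y, Continuous f ∧ Function.Surjective f ∧ ∀ (g : G) (p : X), f (g • p) = g • f p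

/-- The universal minimal flow is a single point. -/
def ExtremelyAmenable (G : Type x) [Group G] [TopologicalSpace G] : Prop :=
  IsUniversalMinimalFlow.{x, 0, z} G PUnit.{1}

/-- The closure of the orbit of `p`, with the restricted action. -/
def orbitClosure (G : Type x) [Group G] {X : Type y} [TopologicalSpace X] [MulAction G X]
    [ContinuousConstSMul G X] (p : X) : SubMulAction G X where
  carrier := closure (MulAction.orbit G p)
  smul_mem' g _ hq := smul_closure_orbit_subset g p (Set.smul_mem_smul_set hq)

end Flows

/-! ### The space of linear orderings -/

/-- The strict linear orderings on `A`, as characteristic functions of subsets of `A × A`. -/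
def LO (A : Type w) : Type w :=
  {r : A → A → Bool // IsStrictTotalOrder A (fun a b => r a b = true)}

/-- The subspace topology from the product `2 ^ (A × A)` of discrete two-point spaces. -/
instance loTopology (A : Type w) : TopologicalSpace (LO A) :=
  instTopologicalSpaceSubtype

section Action

variable {L : FirstOrder.Language.{u, v}} {A : Type w} [L.Structure A]

/-- `a (σ <) b` iff `σ⁻¹ a < σ⁻¹ b`. -/
instance loAction : MulAction (A ≃[L] A) (LO A) where
  smul σ r := ⟨fun a b => r.1 (σ⁻¹ a) (σ⁻¹ b),
    haveI := r.2
    (RelEmbedding.preimage (σ⁻¹).toEquiv.toEmbedding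
      (fun a b => r.1 a b = true)).isStrictTotalOrder⟩
  one_smul _ := rfl
  mul_smul _ _ _ := rfl

instance loContinuousConstSMul : ContinuousConstSMul (A ≃[L] A) (LO A) where
  continuous_const_smul σ := by
    refine Continuous.subtype_mk (continuous_pi fun a => continuous_pi fun b => ?_) _
    exact (continuous_apply (σ⁻¹ b)).comp
      ((continuous_apply (σ⁻¹ a)).comp continuous_subtype_val)

instance loContinuousConstSMulSubgroup (G : Subgroup (A ≃[L] A)) :
    ContinuousConstSMul G (LO A) where
  continuous_const_smul σ := continuous_const_smul (σ : A ≃[L] A)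

end Action

/-! ### Ordered relational structures -/

/-- The only symbol of the signature `{<}`. -/
inductive LTRel : ℕ → Type
  | lt : LTRel 2

/-- The relational signature `{<}` with one binary relation symbol. -/
def ltLanguage : FirstOrder.Language.{0, 0} := ⟨fun _ => Empty, LTRel⟩

/-- The signature `L₀ ∪ {<}`. -/
abbrev withLT (L₀ : FirstOrder.Language.{u, v}) : FirstOrder.Language.{u, v} := L₀.sum ltLanguage

/-- The interpretation of `<` in an `L₀ ∪ {<}`-structure. -/
def ltOf (L₀ : FirstOrder.Language.{u, v}) (M : Type w) [(withLT L₀).Structure M] (a b : M) : Prop :=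
  FirstOrder.Language.Structure.RelMap (L := withLT L₀) (n := 2) (Sum.inr LTRel.lt) ![a, b]

/-- The structure `(A, r)`: the carrier of `A` on which `<` is interpreted as `r`. -/
def Ordered (A : Type w) (_r : LO A) : Type w := A

instance orderedBase (L₀ : FirstOrder.Language.{u, v}) (A : Type w) [s : L₀.Structure A] (r : LO A) :
    L₀.Structure (Ordered A r) := s

instance orderedLT (A : Type w) (r : LO A) : ltLanguage.Structure (Ordered A r) where
  funMap f := Empty.elim f
  RelMap R := match R with
    | LTRel.lt => fun c => r.1 (c 0) (c 1) = true

/-- A class of `L₀ ∪ {<}`-structures contains `(A, r)`. -/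
def ContainsOrdered {L₀ : FirstOrder.Language.{u, v}} (K : Set (Bundled.{w} (withLT L₀).Structure))
    (A : Type w) [L₀.Structure A] (r : LO A) : Prop :=
  (⟨Ordered A r, inferInstance⟩ : Bundled.{w} (withLT L₀).Structure) ∈ K

/-- In all members of the class, `<` is interpreted as a linear ordering. -/
def IsOrderedClass {L₀ : FirstOrder.Language.{u, v}} (K : Set (Bundled.{w} (withLT L₀).Structure)) : Prop :=
  ∀ M ∈ K, IsStrictTotalOrder M (ltOf L₀ M)

/-- `K|L₀`, the class of the `L₀`-reducts of the members of a class of ordered structures. -/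
def reductClass {L₀ : FirstOrder.Language.{u, v}} (K : Set (Bundled.{w} (withLT L₀).Structure)) :
    Set (Bundled.{w} L₀.Structure) :=
  {B | ∃ r : LO B, ContainsOrdered K B r}

/-- Whenever `A ≤ B` are in `K|L₀`, an ordering `r` of `A` with `(A, r) ∈ K` extends to an ordering
`r'` of `B` with `(B, r') ∈ K`. -/
def IsReasonable {L₀ : FirstOrder.Language.{u, v}} (K : Set (Bundled.{w} (withLT L₀).Structure)) : Prop :=
  ∀ B ∈ reductClass K, ∀ A : L₀.Substructure B,
    (⟨A, inferInstance⟩ : Bundled.{w} L₀.Structure) ∈ reductClass K →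
    ∀ r : LO A, ContainsOrdered K A r →
      ∃ r' : LO B, ContainsOrdered K B r' ∧ ∀ a b : A, r.1 a b = r'.1 a b

/-- For every `A ∈ K|L₀` there is `B ∈ K|L₀` such that `(A, r)` embeds into `(B, r')` for all
orderings with `(A, r), (B, r') ∈ K`. -/
def OrderingProperty {L₀ : FirstOrder.Language.{u, v}} (K : Set (Bundled.{w} (withLT L₀).Structure)) : Prop :=
  ∀ A ∈ reductClass K, ∃ B ∈ reductClass K, ∀ (r : LO A) (r' : LO B),
    ContainsOrdered K A r → ContainsOrdered K B r' →
      Nonempty (Ordered A r ↪[withLT L₀] Ordered B r')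

/-! ### Ramsey property, Jónsson classes, universality and homogeneity -/

section Classes

variable {L : FirstOrder.Language.{u, v}}

/-- `C → (B)^A_k`: for every colouring with `k` colours of the copies of `A` in `C` there is a copy
of `B` in `C` all of whose copies of `A` have the same colour. -/
def Arrows (C B A : Bundled.{w} L.Structure) (k : ℕ) : Prop :=
  ∀ c : {S : L.Substructure C // Nonempty (A ≃[L] S)} → Fin k,
    ∃ B' : L.Substructure C, Nonempty (B ≃[L] B') ∧
      ∃ i : Fin k, ∀ S : {S : L.Substructure C // Nonempty (A ≃[L] S)}, S.1 ≤ B' → c S = i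

def RamseyProperty (K : Set (Bundled.{w} L.Structure)) : Prop :=
  ∀ A ∈ K, ∀ B ∈ K, Nonempty (A ↪[L] B) → ∀ k : ℕ, 2 ≤ k → ∃ C ∈ K, Arrows C B A k

def ClosedUnderSubstructures (K : Set (Bundled.{w} L.Structure)) : Prop :=
  ∀ M ∈ K, ∀ S : L.Substructure M, (⟨S, inferInstance⟩ : Bundled.{w} L.Structure) ∈ K

/-- A Jónsson class for the ordinal `α`. -/
structure IsJonssonClass (α : Ordinal.{w}) (K : Set (Bundled.{w} L.Structure)) : Prop where
  large : ∀ ξ : Ordinal.{w}, ∃ M ∈ K, ℵ_ ξ ≤ #M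
  iso_closed : ∀ M ∈ K, ∀ N : Bundled.{w} L.Structure, Nonempty (M ≃[L] N) → N ∈ K
  jointEmbedding : FirstOrder.Language.JointEmbedding K
  amalgamation : FirstOrder.Language.Amalgamation K
  /-- If a structure `M` is the union of a nonempty well-ordered chain of substructures that belong
  to `K`, then `M` belongs to `K`. -/
  chain : ∀ (l : Ordinal.{w}) (M : Bundled.{w} L.Structure) (S : Ordinal.{w} → L.Substructure M),
    0 < l →
    (∀ ξ < l, (⟨S ξ, inferInstance⟩ : Bundled.{w} L.Structure) ∈ K) →
    (∀ ξ ν, ξ < ν → ν < l → S ξ ≤ S ν) →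
    (∀ a : M, ∃ ξ < l, a ∈ S ξ) → M ∈ K
  small : ∀ M ∈ K, ∀ S : L.Substructure M, #S < ℵ_ α →
    ∃ T : L.Substructure M, S ≤ T ∧
      (⟨T, inferInstance⟩ : Bundled.{w} L.Structure) ∈ K ∧ #T < ℵ_ α

/-- `(ℵ_α, K)`-universal. -/
def IsUniversal (α : Ordinal.{w}) (K : Set (Bundled.{w} L.Structure))
    (A : Type w) [L.Structure A] : Prop :=
  (⟨A, inferInstance⟩ : Bundled.{w} L.Structure) ∈ K ∧ #A = ℵ_ α ∧
    ∀ B ∈ K, #B ≤ ℵ_ α → Nonempty (B ↪[L] A)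

/-- `(ℵ_α, K)`-homogeneous. -/
def IsHomogeneous (α : Ordinal.{w}) (K : Set (Bundled.{w} L.Structure))
    (A : Type w) [L.Structure A] : Prop :=
  (⟨A, inferInstance⟩ : Bundled.{w} L.Structure) ∈ K ∧ #A = ℵ_ α ∧
    ∀ B : L.Substructure A, (⟨B, inferInstance⟩ : Bundled.{w} L.Structure) ∈ K → #B < ℵ_ α →
      ∀ f : B ↪[L] A, ∃ g : A ≃[L] A, ∀ b : B, g b = f b

end Classes

end

end JonssonFlows

open JonssonFlows

namespace JonssonFlows

open Filter Topology Uniformity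

/-! ### Neighbourhoods in automorphism groups -/

section Aut

variable {L : FirstOrder.Language.{u, v}} {A : Type w} [L.Structure A]

/-! Everything happens at the finite level. Since `K` is closed under substructures, homogeneity of
`(A, r)` extends every embedding of a finite substructure to an automorphism, and the
Kechris–Pestov–Todorcevic argument applies. For (a), let `Aut(A, r)` act on a compact space. Some
finite `F` is such that automorphisms fixing `F` pointwise move all points only slightly. Colour
each copy `S` of `F` by the approximate position of `γ⁻¹ • y₀`, where `γ` carries `F` to `S`;
rigidity of finite linear orders determines `γ` on `F`. A monochromatic copy of a finite set
containing `F` and its translates under given group elements yields a point that these elements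
barely move, and compactness yields a fixed point (`FinitelyHomogeneous.exists_fixedPoint`). A
compact flow of a dense subgroup extends to the whole group (`exists_flow_extension`). For (b),
extend a minimal `G`-flow to `Aut(A)` and take a point `y` fixed by `Aut(A, r)`. By homogeneity, if
`g • r` and `g' • r` agree on a large finite set, then `g • y` and `g' • y` are close
(`FinitelyHomogeneous.exists_forall_smul_near`). So `g • r ↦ g • y` extends to the orbit closure,
onto by minimality. The ordering property makes the orbit closure itself minimal
(`FinitelyHomogeneous.mem_closure_orbit`). -/

theorem aut_inv_apply_self (g : A ≃[L] A) (a : A) : g⁻¹ (g a) = a :=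
  g.symm_apply_apply a

theorem aut_apply_inv_self (g : A ≃[L] A) (a : A) : g (g⁻¹ a) = a :=
  g.apply_symm_apply a

theorem eventually_aut_apply_eq (g : A ≃[L] A) (a : A) : ∀ᶠ h in 𝓝 g, h a = g a := by
  let _ : TopologicalSpace A := ⊥
  have _ : DiscreteTopology A := ⟨rfl⟩
  have hc : Continuous (fun (h : A ≃[L] A) (b : A) => h b) := continuous_induced_dom
  exact ((continuous_apply a).comp hc).continuousAt.eventually
    (IsOpen.mem_nhds (isOpen_discrete {g a}) rfl)

theorem mem_nhds_aut_iff {g : A ≃[L] A} {s : Set (A ≃[L] A)} :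
    s ∈ 𝓝 g ↔ ∃ F : Finset A, ∀ h : A ≃[L] A, (∀ a ∈ F, h a = g a) → h ∈ s := by
  constructor
  · intro hs
    let _ : TopologicalSpace A := ⊥
    have _ : DiscreteTopology A := ⟨rfl⟩
    rw [show 𝓝 g = comap (fun (h : A ≃[L] A) (b : A) => h b) (𝓝 fun b => g b) from
      nhds_induced _ _, nhds_pi] at hs
    obtain ⟨t, ht, hts⟩ := hs
    rw [Filter.mem_pi] at ht
    obtain ⟨I, hI, u, hu, hut⟩ := ht
    refine ⟨hI.toFinset, fun h hh => hts (hut fun a ha => ?_)⟩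
    change h a ∈ u a
    rw [hh a (hI.mem_toFinset.2 ha)]
    exact mem_of_mem_nhds (hu a)
  · rintro ⟨F, hF⟩
    filter_upwards [(Finset.eventually_all F).2 fun a _ => eventually_aut_apply_eq g a] with h hh
    exact hF h hh

theorem eventually_aut_inv_apply_eq (g : A ≃[L] A) (a : A) : ∀ᶠ h in 𝓝 g, h⁻¹ a = g⁻¹ a := by
  filter_upwards [eventually_aut_apply_eq g (g⁻¹ a)] with h hh
  rw [aut_apply_inv_self] at hh
  conv_lhs => rw [← hh]
  exact aut_inv_apply_self h _

instance autIsTopologicalGroup : IsTopologicalGroup (A ≃[L] A) where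
  continuous_mul := continuous_iff_continuousAt.2 fun ⟨g, h⟩ s hs => by
    obtain ⟨F, hF⟩ := mem_nhds_aut_iff.1 hs
    have h₁ : ∀ᶠ p : (A ≃[L] A) × (A ≃[L] A) in 𝓝 (g, h), ∀ a ∈ F, p.2 a = h a :=
      (Finset.eventually_all F).2 fun a _ =>
        (continuous_snd.tendsto (g, h)).eventually (eventually_aut_apply_eq h a)
    have h₂ : ∀ᶠ p : (A ≃[L] A) × (A ≃[L] A) in 𝓝 (g, h), ∀ a ∈ F, p.1 (h a) = g (h a) :=
      (Finset.eventually_all F).2 fun a _ =>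
        (continuous_fst.tendsto (g, h)).eventually (eventually_aut_apply_eq g (h a))
    refine mem_map.2 ((h₁.and h₂).mono fun p ⟨hp₁, hp₂⟩ => hF _ fun a ha => ?_)
    change p.1 (p.2 a) = g (h a)
    rw [hp₁ a ha, hp₂ a ha]
  continuous_inv := continuous_iff_continuousAt.2 fun g s hs => by
    obtain ⟨F, hF⟩ := mem_nhds_aut_iff.1 hs
    have h₁ : ∀ᶠ h in 𝓝 g, ∀ a ∈ F, h⁻¹ a = g⁻¹ a :=
      (Finset.eventually_all F).2 fun a _ => eventually_aut_inv_apply_eq g a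
    exact mem_map.2 (h₁.mono fun h hh => hF _ hh)

theorem exists_mem_eqOn_of_dense {G : Subgroup (A ≃[L] A)} (hG : Dense (G : Set (A ≃[L] A)))
    (h : A ≃[L] A) (F : Finset A) : ∃ g : G, ∀ a ∈ F, (g : A ≃[L] A) a = h a := by
  obtain ⟨g, hg, hgG⟩ := mem_closure_iff_nhds.1 (hG h) {g | ∀ a ∈ F, g a = h a}
    (mem_nhds_aut_iff.2 ⟨F, fun _ => id⟩)
  exact ⟨⟨g, hgG⟩, hg⟩

end Aut

/-! ### Compact flows -/

section Flow

/-- The hypothesis makes `f` Cauchy along the trace of each neighbourhood filter. No topology on `D`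
and no injectivity of `i` is needed: `D` gets the topology induced by `i`. -/
theorem exists_continuous_extension {D : Type*} {P : Type*} {Y : Type*} [TopologicalSpace P]
    [UniformSpace Y] [CompleteSpace Y] [T2Space Y] {i : D → P} (hi : DenseRange i) (f : D → Y)
    (hf : ∀ p, ∀ V ∈ 𝓤 Y, ∃ U ∈ 𝓝 p, ∀ d d', i d ∈ U → i d' ∈ U → (f d, f d') ∈ V) :
    ∃ F : P → Y, Continuous F ∧ ∀ d, F (i d) = f d := by
  let _ : TopologicalSpace D := TopologicalSpace.induced i inferInstance
  have di : IsDenseInducing i := ⟨⟨rfl⟩, hi⟩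
  have hlim : ∀ p, ∃ c, Tendsto f (comap i (𝓝 p)) (𝓝 c) := fun p => by
    have := di.comap_nhds_neBot p
    refine cauchy_iff_exists_le_nhds.1 (cauchy_map_iff.2 ⟨this, fun V hV => ?_⟩)
    obtain ⟨U, hU, h⟩ := hf p V hV
    exact mem_map.2 (mem_of_superset (prod_mem_prod (preimage_mem_comap hU) (preimage_mem_comap hU))
      fun q hq => h _ _ hq.1 hq.2)
  refine ⟨di.extend f, di.continuous_extend hlim, fun d => ?_⟩
  obtain ⟨c, hc⟩ := hlim (i d)
  -- The trace filter at `i d` contains `d` in every member, so its limit under `f` can only be `f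
  -- d`.
  have hd : pure d ≤ comap i (𝓝 (i d)) := map_le_iff_le_comap.1 (by simpa using pure_le_nhds (i d))
  rw [di.extend_eq_of_tendsto hc]
  exact tendsto_nhds_unique (hc.mono_left hd) (tendsto_pure_nhds f d)

variable {G : Type*} [Group G]

/-- Compactness of `Y` makes continuity of the action at the identity uniform in `y`. -/
theorem eventually_forall_smul_mem_uniformity [TopologicalSpace G]
    {Y : Type*} [UniformSpace Y] [CompactSpace Y] [MulAction G Y] [ContinuousSMul G Y]
    {V : Set (Y × Y)} (hV : V ∈ 𝓤 Y) :
    ∀ᶠ g in 𝓝 (1 : G), ∀ y : Y, (g • y, y) ∈ V := by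
  have := isCompact_univ.eventually_forall_of_forall_eventually (x₀ := (1 : G))
    (P := fun g (y : Y) => (g • y, y) ∈ V) fun y _ => ?_
  · simpa using this
  · have hc : Continuous fun q : G × Y => (q.1 • q.2, q.2) := by fun_prop
    refine (hc.tendsto ((1 : G), y)).eventually ?_
    rw [one_smul]
    exact nhds_le_uniformity y hV

/-- A compact flow of a dense subgroup extends to the whole group. -/
theorem exists_flow_extension [TopologicalSpace G]
    {H : Type*} [Group H] [TopologicalSpace H] [IsTopologicalGroup H]
    (i : G →* H) (hi : IsInducing i) (hd : DenseRange i)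
    (Y : Type*) [TopologicalSpace Y] [CompactSpace Y] [T2Space Y] [MulAction G Y]
    [ContinuousSMul G Y] :
    ∃ _ : MulAction H Y, ContinuousSMul H Y ∧ ∀ (g : G) (y : Y), i g • y = g • y := by
  let _ : UniformSpace Y := uniformSpaceOfCompactR1
  obtain ⟨F, hF, hFi⟩ := exists_continuous_extension (i := Prod.map i (id : Y → Y))
    (hd.prodMap denseRange_id) (fun q : G × Y => q.1 • q.2) fun ⟨h, y⟩ V hV => by
      obtain ⟨V', hV', hsymm', hVV'⟩ := comp_symm_mem_uniformity_sets hV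
      obtain ⟨W, hW, hsymm, hWW⟩ := comp_symm_mem_uniformity_sets hV'
      have h1 := eventually_forall_smul_mem_uniformity (G := G) hW
      rw [hi.nhds_eq_comap, map_one] at h1
      obtain ⟨O, hO, hOW⟩ := h1
      have hc : Continuous fun q : H × H => q.1 * q.2⁻¹ := by fun_prop
      have h2 : ∀ᶠ q in 𝓝 (h, h), q.1 * q.2⁻¹ ∈ O :=
        (hc.tendsto (h, h)).eventually (by simpa using hO)
      rw [nhds_prod_eq] at h2
      obtain ⟨U, hU, hUO⟩ := mem_prod_same_iff.1 h2
      -- Compare with one fixed `g₀`: write `g • z = (g * g₀⁻¹) • g₀ • z`. The first factor is near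
      -- the identity, hence uniformly harmless, and `g₀` acts continuously.
      obtain ⟨g₀, hg₀⟩ := hd.mem_nhds hU
      have h3 : ∀ᶠ z in 𝓝 y, (g₀ • z, g₀ • y) ∈ W := by
        have : ContinuousAt (fun z : Y => g₀ • z) y := (continuous_const_smul g₀).continuousAt
        exact this.eventually (mem_nhds_right (g₀ • y) hW)
      have key : ∀ q : G × Y, i q.1 ∈ U → (g₀ • q.2, g₀ • y) ∈ W →
          (q.1 • q.2, g₀ • y) ∈ V' := fun q hq hq' => by
        refine hWW ⟨g₀ • q.2, ?_, hq'⟩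
        have := hOW (a := q.1 * g₀⁻¹) (by simpa using hUO (Set.mk_mem_prod hq hg₀)) (g₀ • q.2)
        simpa [mul_smul] using this
      refine ⟨_, prod_mem_nhds hU h3, fun q q' hq hq' => hVV' ⟨g₀ • y, ?_, ?_⟩⟩
      · exact key q hq.1 hq.2
      · exact hsymm'.symm _ _ (key q' hq'.1 hq'.2)
  have hFi' : ∀ (g : G) (y : Y), F (i g, y) = g • y := fun g y => hFi (g, y)
  let _ : SMul H Y := ⟨fun h y => F (h, y)⟩
  refine ⟨{ one_smul := fun y => ?_, mul_smul := fun h k y => ?_ }, ⟨hF⟩, hFi'⟩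
  · change F (h * k, y) = F (h, F (k, y))
    refine hd.induction_on₂ (p := fun h k => F (h * k, y) = F (h, F (k, y))) ?_ ?_ h k
    · exact isClosed_eq (by fun_prop) (by fun_prop)
    · intro g g'
      rw [← map_mul, hFi', hFi', hFi', mul_smul]
  · change F (1, y) = y
    have := hFi' 1 y
    rwa [map_one, one_smul] at this

theorem exists_coloring_of_uniformity {Y : Type*} [UniformSpace Y] [CompactSpace Y]
    {V : Set (Y × Y)} (hV : V ∈ 𝓤 Y) :
    ∃ k : ℕ, 2 ≤ k ∧ ∃ c : Y → Fin k, ∀ y y', c y = c y' → (y, y') ∈ V := by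
  obtain ⟨W, hW, hsymm, hWV⟩ := comp_symm_mem_uniformity_sets hV
  obtain ⟨t, ht, hcov⟩ := (isCompact_univ (X := Y)).totallyBounded W hW
  have hex : ∀ y : Y, ∃ q : t, (y, (q : Y)) ∈ W := fun y => by
    simpa using hcov (Set.mem_univ y)
  choose d hd using hex
  have := ht.fintype
  -- The colour is the chosen point of a finite net; two unused colours ensure `2 ≤ k`.
  refine ⟨Fintype.card t + 2, by omega, fun y => (Fintype.equivFin t (d y)).castAdd 2,
    fun y y' h => hWV ⟨d y, hd y, hsymm.symm _ _ ?_⟩⟩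
  rw [(Fintype.equivFin t).injective (Fin.castAdd_injective _ _ h)]
  exact hd y'

/-- The sets of points that `g` moves within a closed entourage are closed and have the finite
intersection property; a common point is fixed because `Y` is Hausdorff. -/
theorem exists_fixedPoint_of_forall_finset {Y : Type*} [UniformSpace Y] [CompactSpace Y]
    [T2Space Y] [MulAction G Y] [ContinuousConstSMul G Y]
    (h : ∀ V ∈ 𝓤 Y, ∀ s : Finset G, ∃ y : Y, ∀ g ∈ s, (y, g • y) ∈ V) :
    ∃ y : Y, ∀ g : G, g • y = y := by
  classical
  obtain ⟨y, -, hy⟩ := (isCompact_univ (X := Y)).inter_iInter_nonempty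
    (fun i : {V : Set (Y × Y) // V ∈ 𝓤 Y ∧ IsClosed V} × G => {y | (y, i.2 • y) ∈ i.1.1})
    (fun i => i.1.2.2.preimage (continuous_id.prodMk (continuous_const_smul i.2))) fun u => by
      obtain ⟨y, hy⟩ := h (⋂ i ∈ u, i.1.1) ((biInter_finset_mem u).2 fun i _ => i.1.2.1)
        (u.image Prod.snd)
      refine ⟨y, trivial, Set.mem_iInter₂.2 fun i hi => ?_⟩
      exact Set.mem_iInter₂.1 (hy i.2 (Finset.mem_image_of_mem _ hi)) i hi
  refine ⟨y, fun g => (eq_of_uniformity_basis uniformity_hasBasis_closed fun {V} hV => ?_).symm⟩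
  exact Set.mem_iInter.1 hy (⟨V, hV⟩, g)

/-- The orbit of a fixed point is a closed singleton, so its density forces a minimal flow to be one
point. -/
theorem extremelyAmenable_of_exists_fixedPoint [TopologicalSpace G]
    (h : ∀ (Y : Type z) [TopologicalSpace Y] [MulAction G Y], IsMinimalFlow G Y →
      ∃ y : Y, ∀ g : G, g • y = y) : ExtremelyAmenable.{_, z} G where
  isMinimalFlow := ⟨inferInstance, inferInstance, inferInstance, ⟨continuous_const⟩,
    ⟨fun _ _ => subset_closure ⟨1, rfl⟩⟩⟩
  universal Y _ _ hY := by
    obtain ⟨y, hy⟩ := h Y hY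
    have := hY.hausdorff
    refine ⟨fun _ => y, continuous_const, fun q => ⟨PUnit.unit, ?_⟩, fun g _ => (hy g).symm⟩
    have horb : MulAction.orbit G y = {y} := by
      ext q
      simp [MulAction.mem_orbit_iff, hy, eq_comm]
    have hq := hY.minimal.dense_orbit y q
    rw [horb, closure_singleton] at hq
    exact hq.symm

/-- The map is `g • p ↦ g • y`, extended by continuity. Equivariance passes to the closure, and the
image is closed, invariant and nonempty, hence everything by minimality. -/
theorem exists_surjective_of_orbitClosure {X : Type*} [TopologicalSpace X]
    [MulAction G X] [ContinuousConstSMul G X] [CompactSpace X] (p : X)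
    {Y : Type*} [UniformSpace Y] [CompactSpace Y] [T2Space Y] [MulAction G Y]
    [ContinuousConstSMul G Y] [MulAction.IsMinimal G Y] (y : Y)
    (h : ∀ q : X, ∀ V ∈ 𝓤 Y, ∃ U ∈ 𝓝 q, ∀ g g' : G, g • p ∈ U → g' • p ∈ U →
      (g • y, g' • y) ∈ V) :
    ∃ f : orbitClosure G p → Y, Continuous f ∧ Function.Surjective f ∧
      ∀ (g : G) (q : orbitClosure G p), f (g • q) = g • f q := by
  have hcl : IsClosed (orbitClosure G p : Set X) := isClosed_closure
  have _ : CompactSpace (orbitClosure G p) := isCompact_iff_compactSpace.1 hcl.isCompact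
  let i : G → orbitClosure G p := fun g => ⟨g • p, subset_closure ⟨g, rfl⟩⟩
  have hi : DenseRange i := fun q => by
    rw [closure_subtype, ← Set.range_comp]
    exact q.2
  obtain ⟨f, hf, hfi⟩ := exists_continuous_extension hi (fun g => g • y) fun q V hV => by
    obtain ⟨U, hU, hUV⟩ := h q V hV
    exact ⟨_, continuous_subtype_val.continuousAt.preimage_mem_nhds hU, hUV⟩
  have heq : ∀ (g : G) (q : orbitClosure G p), f (g • q) = g • f q := fun g q => by
    refine hi.induction_on (p := fun q => f (g • q) = g • f q) q ?_ fun g' => ?_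
    · have hg : Continuous fun q : orbitClosure G p => g • q :=
        (continuous_subtype_val.const_smul g).subtype_mk _
      exact isClosed_eq (hf.comp hg) (hf.const_smul g)
    · rw [hfi, ← mul_smul, ← hfi]
      exact congrArg f (Subtype.ext (mul_smul g g' p).symm)
  refine ⟨f, hf, ?_, heq⟩
  refine Set.range_eq_univ.1 ((eq_empty_or_univ_of_smul_invariant_closed G
    (isCompact_range hf).isClosed fun g => ?_).resolve_left ?_)
  · rintro _ ⟨_, ⟨q, rfl⟩, rfl⟩
    exact ⟨g • q, heq g q⟩
  · exact (Set.range_nonempty_iff_nonempty.2 ⟨i 1⟩).ne_empty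

end Flow

/-! ### Fixed points from the Ramsey property -/

section Ramsey

variable {L : FirstOrder.Language.{u, v}} {M : Type w} [L.Structure M]

/-- Finite partial isomorphisms of `M` extend to automorphisms. -/
def FinitelyHomogeneous (L : FirstOrder.Language.{u, v}) (M : Type w) [L.Structure M] : Prop :=
  ∀ B : L.Substructure M, Finite B → ∀ f : B ↪[L] M, ∃ g : M ≃[L] M, ∀ b : B, g b = f b

/-- Finite substructures of `M` have at most one isomorphism to any given structure. -/
def FinitelyRigid (L : FirstOrder.Language.{u, v}) (M : Type w) [L.Structure M] : Prop :=
  ∀ B : L.Substructure M, Finite B → ∀ (N : Type w) [L.Structure N] (e e' : B ≃[L] N), e = e'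

theorem FinitelyHomogeneous.exists_fixedPoint [L.IsRelational] (hhom : FinitelyHomogeneous L M)
    (hrigid : FinitelyRigid L M) (hR : RamseyProperty (L.age M))
    (Y : Type z) [TopologicalSpace Y] [CompactSpace Y] [T2Space Y] [Nonempty Y]
    [MulAction (M ≃[L] M) Y] [ContinuousSMul (M ≃[L] M) Y] :
    ∃ y : Y, ∀ g : M ≃[L] M, g • y = y := by
  classical
  let _ : UniformSpace Y := uniformSpaceOfCompactR1
  refine exists_fixedPoint_of_forall_finset fun U hU s => ?_
  obtain ⟨U', hU', hU'symm, hUU'⟩ := comp_symm_mem_uniformity_sets hU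
  obtain ⟨V, hV, hVsymm, hVU'⟩ := comp_symm_mem_uniformity_sets hU'
  obtain ⟨k, hk, c, hc⟩ := exists_coloring_of_uniformity hV
  obtain ⟨F₀, hF₀⟩ := mem_nhds_aut_iff.1
    (eventually_forall_smul_mem_uniformity (G := M ≃[L] M) hV)
  let F : L.Substructure M := FirstOrder.Language.Substructure.closure L (F₀ : Set M)
  have hF : ∀ a, a ∈ F ↔ a ∈ F₀ := fun a =>
    FirstOrder.Language.Substructure.mem_closure_iff_of_isRelational L _ a
  have hFfin : Finite F :=
    (F₀.finite_toSet.subset fun a ha => (hF a).1 ha).to_subtype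
  -- `1` is included so that the final point itself is compared with the common colour, alongside
  -- its translates by `s`.
  let B₀ : Finset M := (insert 1 s).biUnion fun g => F₀.image fun a => g⁻¹ a
  let B : L.Substructure M := FirstOrder.Language.Substructure.closure L (B₀ : Set M)
  have hB : ∀ a, a ∈ B ↔ a ∈ B₀ := fun a =>
    FirstOrder.Language.Substructure.mem_closure_iff_of_isRelational L _ a
  have hBfin : Finite B :=
    (B₀.finite_toSet.subset fun a ha => (hB a).1 ha).to_subtype
  have hgB : ∀ g ∈ insert 1 s, ∀ a : F, g⁻¹ (a : M) ∈ B := fun g hg a => by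
    rw [hB]
    exact Finset.mem_biUnion.2 ⟨g, hg, Finset.mem_image_of_mem _ ((hF _).1 a.2)⟩
  let emb : ∀ g ∈ insert 1 s, F ↪[L] B := fun g hg =>
    ((g⁻¹).toEmbedding.comp F.subtype).codRestrict B (hgB g hg)
  obtain ⟨C, ⟨-, ⟨ι⟩⟩, hC⟩ := hR ⟨F, inferInstance⟩
    ⟨FirstOrder.Language.Structure.FG.of_finite, ⟨F.subtype⟩⟩ ⟨B, inferInstance⟩
    ⟨FirstOrder.Language.Structure.FG.of_finite, ⟨B.subtype⟩⟩
    ⟨emb 1 (Finset.mem_insert_self _ _)⟩ k hk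
  have hext : ∀ S : {S : L.Substructure C // Nonempty (F ≃[L] S)}, ∃ g : M ≃[L] M,
      ∃ e : F ≃[L] S.1, ∀ a : F, g a = ι (e a) := fun ⟨S, ⟨e⟩⟩ => by
    obtain ⟨g, hg⟩ := hhom F hFfin ((ι.comp S.subtype).comp e.toEmbedding)
    exact ⟨g, e, hg⟩
  choose γ e hγ using hext
  obtain ⟨y₀⟩ := ‹Nonempty Y›
  obtain ⟨B', ⟨eB⟩, i, hi⟩ := hC fun S => c ((γ S)⁻¹ • y₀)
  obtain ⟨g, hg⟩ := hhom B hBfin ((ι.comp B'.subtype).comp eB.toEmbedding)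
  have hclose : ∀ h ∈ insert 1 s, ∃ y', c y' = i ∧ (h • g⁻¹ • y₀, y') ∈ V := fun h hh => by
    let j : F ↪[L] C := (B'.subtype.comp eB.toEmbedding).comp (emb h hh)
    let S : {S : L.Substructure C // Nonempty (F ≃[L] S)} := ⟨j.toHom.range, ⟨j.equivRange⟩⟩
    refine ⟨(γ S)⁻¹ • y₀, hi S ?_, ?_⟩
    · rintro _ ⟨a, rfl⟩
      exact (eB (emb h hh a)).2
    · have hS : ∀ a ∈ F₀, (h * g⁻¹ * γ S) a = (1 : M ≃[L] M) a := fun a ha => by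
        have haF := (hF a).2 ha
        have h1 : γ S a = g (h⁻¹ a) := by
          rw [show γ S a = _ from hγ S ⟨a, haF⟩, hrigid F hFfin _ (e S) j.equivRange]
          exact (hg ⟨h⁻¹ a, hgB h hh ⟨a, haF⟩⟩).symm
        change h (g⁻¹ (γ S a)) = a
        rw [h1, aut_inv_apply_self, aut_apply_inv_self]
      simpa [mul_smul] using hF₀ _ hS ((γ S)⁻¹ • y₀)
  obtain ⟨y₁, hy₁, hV₁⟩ := hclose 1 (Finset.mem_insert_self _ _)
  refine ⟨g⁻¹ • y₀, fun h hh => ?_⟩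
  obtain ⟨y₂, hy₂, hV₂⟩ := hclose h (Finset.mem_insert_of_mem hh)
  rw [one_smul] at hV₁
  refine hUU' ⟨y₁, hVU' ⟨y₁, hV₁, hc _ _ rfl⟩, hU'symm.symm _ _ (hVU' ⟨y₂, hV₂, hc _ _ ?_⟩)⟩
  rw [hy₁, hy₂]

end Ramsey

/-! ### Ordered structures -/

section Ordered

instance ltLanguage_isRelational : ltLanguage.IsRelational := fun _ =>
  inferInstanceAs (IsEmpty Empty)

variable {L₀ : FirstOrder.Language.{u, v}} {A : Type w} [L₀.Structure A]

theorem lo_smul_apply (g : A ≃[L₀] A) (r : LO A) (a b : A) :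
    (g • r).1 a b = r.1 (g⁻¹ a) (g⁻¹ b) := rfl

/-- The ordering of `B` pulled back along an injection into an ordered set. -/
def LO.comap {B : Type w} (f : B ↪ A) (r : LO A) : LO B :=
  ⟨fun a b => r.1 (f a) (f b),
    haveI := r.2
    (RelEmbedding.preimage f (fun a b => r.1 a b = true)).isStrictTotalOrder⟩

/-- An order-preserving embedding of `L₀`-structures as an embedding of ordered structures. -/
def orderedEmbedding {B : Type w} [L₀.Structure B] {s : LO B} {r : LO A} (f : B ↪[L₀] A)
    (h : ∀ a b, r.1 (f a) (f b) = s.1 a b) : Ordered B s ↪[withLT L₀] Ordered A r where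
  toFun := f
  inj' := f.injective
  map_fun' {n} φ := by
    cases φ with
    | inl φ => exact f.map_fun φ
    | inr φ => exact Empty.elim φ
  map_rel' {n} R x := by
    cases R with
    | inl R => exact f.map_rel R x
    | inr R =>
      cases R
      exact iff_of_eq (congrArg (· = true) (h (x 0) (x 1)))

/-- The embedding of reducts underlying an embedding of ordered structures. -/
def reductEmbedding {B : Type w} [L₀.Structure B] {s : LO B} {r : LO A}
    (f : Ordered B s ↪[withLT L₀] Ordered A r) : B ↪[L₀] A where
  toFun := f
  inj' := f.injective
  map_fun' φ x := f.map_fun (Sum.inl φ) x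
  map_rel' R x := f.map_rel (Sum.inl R) x

theorem lo_map {B : Type w} [L₀.Structure B] {s : LO B} {r : LO A}
    (f : Ordered B s ↪[withLT L₀] Ordered A r) (a b : B) :
    r.1 (reductEmbedding f a) (reductEmbedding f b) = s.1 a b :=
  Bool.eq_iff_iff.2 (f.map_rel (Sum.inr LTRel.lt) ![a, b])

/-- The automorphism of the reduct underlying an automorphism of an ordered structure. -/
def reductAut (r : LO A) : (Ordered A r ≃[withLT L₀] Ordered A r) →* (A ≃[L₀] A) where
  toFun f :=
    { toEquiv := f.toEquiv
      map_fun' := fun φ x => f.map_fun (Sum.inl φ) x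
      map_rel' := fun R x => f.map_rel (Sum.inl R) x }
  map_one' := rfl
  map_mul' _ _ := rfl

theorem continuous_reductAut (r : LO A) : Continuous (reductAut (L₀ := L₀) r) :=
  continuous_induced_rng.2 continuous_induced_dom

/-- A finite linear order is a well-order, so its only automorphism is the identity; this applies to
`e'⁻¹ ∘ e`. -/
theorem finitelyRigid_ordered (r : LO A) : FinitelyRigid (withLT L₀) (Ordered A r) := by
  intro B _ N _ e e'
  let lt : B → B → Prop := fun a b => r.1 a.1 b.1 = true
  have _ : IsStrictTotalOrder (Ordered A r) fun a b => r.1 a b = true := r.2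
  have _ : IsStrictTotalOrder B lt :=
    (RelEmbedding.preimage (Function.Embedding.subtype (· ∈ B))
      (fun a b : Ordered A r => r.1 a b = true)).isStrictTotalOrder
  have _ : IsWellOrder B lt := { wf := Finite.wellFounded_of_trans_of_irrefl lt }
  let g : B ≃[withLT L₀] B := e'.symm.comp e
  let f : lt ≃r lt := ⟨g.toEquiv, fun {a b} => g.map_rel (Sum.inr LTRel.lt) ![a, b]⟩
  refine FirstOrder.Language.Equiv.ext fun a => ?_
  have hf : f.toInitialSeg = InitialSeg.refl lt := Subsingleton.elim _ _
  have ha : e'.symm (e a) = a := DFunLike.congr_fun hf a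
  rw [← e'.apply_symm_apply (e a), ha]

/-- Closure under substructures puts every finite substructure in `K`, and finite means smaller than
`ℵ_ α`. -/
theorem finitelyHomogeneous_of_isHomogeneous {L : FirstOrder.Language.{u, v}} {M : Type w}
    [L.Structure M] {α : Ordinal.{w}} {K : Set (Bundled.{w} L.Structure)}
    (hsub : ClosedUnderSubstructures K) (h : IsHomogeneous α K M) : FinitelyHomogeneous L M :=
  fun B _ => h.2.2 B (hsub _ h.1 B) ((Cardinal.lt_aleph0_of_finite B).trans_le (aleph0_le_aleph α))

theorem isStrictTotalOrder_iff_bool (r : A → A → Bool) :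
    IsStrictTotalOrder A (fun a b => r a b = true) ↔ ∀ a b c, r a a = false ∧
      (r a b = true → r b c = true → r a c = true) ∧ (r a b = false → r b a = false → a = b) := by
  constructor
  · intro h a b c
    refine ⟨Bool.eq_false_iff.2 (h.irrefl a), h.trans a b c, fun h₁ h₂ => h.trichotomous a b ?_ ?_⟩
    · simp [h₁]
    · simp [h₂]
  · intro h
    exact
      { irrefl := fun a => Bool.eq_false_iff.1 (h a a a).1
        trans := fun a b c => (h a b c).2.1
        trichotomous := fun a b h₁ h₂ =>
          (h a b a).2.2 (Bool.eq_false_iff.2 h₁) (Bool.eq_false_iff.2 h₂) }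

/-- Each instance of an order axiom constrains only finitely many coordinates, so the orderings form
a closed subset of a compact product. -/
instance compactSpace_lo (A : Type w) : CompactSpace (LO A) := by
  refine isCompact_iff_compactSpace.1 (IsClosed.isCompact
    (X := A → A → Bool) (s := {r | IsStrictTotalOrder A fun a b => r a b = true}) ?_)
  simp only [isStrictTotalOrder_iff_bool, Set.ofPred_forall]
  refine isClosed_iInter fun a => isClosed_iInter fun b => isClosed_iInter fun c => ?_
  have hc : Continuous fun r : A → A → Bool => (r a a, r a b, r b c, r a c, r b a) := by fun_prop
  exact (isClosed_discrete {x : Bool × Bool × Bool × Bool × Bool | x.1 = false ∧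
    (x.2.1 = true → x.2.2.1 = true → x.2.2.2.1 = true) ∧
    (x.2.1 = false → x.2.2.2.2 = false → a = b)}).preimage hc

instance t2Space_lo (A : Type w) : T2Space (LO A) :=
  inferInstanceAs (T2Space {r : A → A → Bool // IsStrictTotalOrder A (fun a b => r a b = true)})

theorem continuous_lo_apply (a b : A) : Continuous fun q : LO A => q.1 a b :=
  (continuous_apply b).comp ((continuous_apply a).comp continuous_subtype_val)

instance continuousSMul_lo : ContinuousSMul (A ≃[L₀] A) (LO A) where
  continuous_smul := by
    refine Continuous.subtype_mk (continuous_pi fun a => continuous_pi fun b =>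
      continuous_iff_continuousAt.2 fun ⟨g, q⟩ => ?_) _
    have hc : ContinuousAt (fun p : (A ≃[L₀] A) × LO A => p.2.1 (g⁻¹ a) (g⁻¹ b)) (g, q) :=
      ((continuous_lo_apply _ _).comp continuous_snd).continuousAt
    -- Near `g` the inverse images of `a` and `b` are constant, so the coordinate is locally an
    -- evaluation at fixed points.
    refine hc.congr ?_
    filter_upwards [(continuous_fst.tendsto (g, q)).eventually (eventually_aut_inv_apply_eq g a),
      (continuous_fst.tendsto (g, q)).eventually (eventually_aut_inv_apply_eq g b)] with p h₁ h₂
    rw [← h₁, ← h₂]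

theorem mem_nhds_lo_iff {r : LO A} {s : Set (LO A)} :
    s ∈ 𝓝 r ↔ ∃ F : Finset A, ∀ q : LO A, (∀ a ∈ F, ∀ b ∈ F, q.1 a b = r.1 a b) → q ∈ s := by
  classical
  constructor
  · intro hs
    rw [show 𝓝 r = _ from nhds_induced _ _, nhds_pi] at hs
    obtain ⟨t, ht, hts⟩ := hs
    obtain ⟨I, hI, u, hu, hut⟩ := Filter.mem_pi.1 ht
    have hu' : ∀ a, ∃ J : Finset A, ∀ f : A → Bool, (∀ b ∈ J, f b = r.1 a b) → f ∈ u a :=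
      fun a => by
        have := hu a
        rw [nhds_pi] at this
        obtain ⟨J, hJ, v, hv, hvu⟩ := Filter.mem_pi.1 this
        refine ⟨hJ.toFinset, fun f hf => hvu fun b hb => ?_⟩
        rw [hf b (hJ.mem_toFinset.2 hb)]
        exact mem_of_mem_nhds (hv b)
    choose J hJ using hu'
    refine ⟨hI.toFinset ∪ hI.toFinset.biUnion J, fun q hq => hts (hut fun a ha => hJ a _ ?_)⟩
    have ha' := hI.mem_toFinset.2 ha
    exact fun b hb => hq a (Finset.mem_union_left _ ha') b
      (Finset.mem_union_right _ (Finset.mem_biUnion.2 ⟨a, ha', hb⟩))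
  · rintro ⟨F, hF⟩
    have h : ∀ᶠ q in 𝓝 r, ∀ a ∈ F, ∀ b ∈ F, q.1 a b = r.1 a b :=
      (Finset.eventually_all F).2 fun a _ => (Finset.eventually_all F).2 fun b _ =>
        (continuous_lo_apply a b).continuousAt.eventually
          (IsOpen.mem_nhds (isOpen_discrete {r.1 a b}) rfl)
    exact h.mono hF

end Ordered

/-! ### The flow of orderings -/

section OrderFlow

variable {L₀ : FirstOrder.Language.{u, v}} [L₀.IsRelational] {A : Type w} [L₀.Structure A]
  {r : LO A}

theorem mem_closure_finset (F : Finset A) (a : A) :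
    a ∈ FirstOrder.Language.Substructure.closure L₀ (F : Set A) ↔ a ∈ F :=
  FirstOrder.Language.Substructure.mem_closure_iff_of_isRelational L₀ _ a

theorem finite_closure_finset (F : Finset A) :
    Finite (FirstOrder.Language.Substructure.closure L₀ (F : Set A)) :=
  (F.finite_toSet.subset fun a ha => (mem_closure_finset F a).1 ha).to_subtype

theorem FinitelyHomogeneous.exists_extension
    (hhom : FinitelyHomogeneous (withLT L₀) (Ordered A r)) (B : L₀.Substructure A) [Finite B]
    (f : B ↪[L₀] A) (hf : ∀ a b : B, r.1 (f a) (f b) = r.1 a b) :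
    ∃ τ : Ordered A r ≃[withLT L₀] Ordered A r, ∀ a : B, reductAut r τ a = f a := by
  let B' : (withLT L₀).Substructure (Ordered A r) :=
    ⟨(B : Set A), fun φ => isEmptyElim φ⟩
  let f' : B' ↪[withLT L₀] Ordered A r :=
    { toFun := f
      inj' := f.injective
      map_fun' := fun φ => isEmptyElim φ
      map_rel' := fun {n} R x => by
        cases R with
        | inl R => exact f.map_rel R x
        | inr R =>
          cases R
          exact iff_of_eq (congrArg (· = true) (hf (x 0) (x 1))) }
  exact hhom B' ‹_› f'

/-- If the two orderings agree on `F`, then `g⁻¹ * g'` preserves `r` on `g'⁻¹ F` and extends from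
there to some `τ` in `Aut(A, r)`. Then `g * τ * g'⁻¹` fixes `F` pointwise and takes `g' • y` to `g •
y`, since `τ` fixes `y`. -/
theorem FinitelyHomogeneous.exists_forall_smul_near
    (hhom : FinitelyHomogeneous (withLT L₀) (Ordered A r))
    {Y : Type*} [UniformSpace Y] [CompactSpace Y] [MulAction (A ≃[L₀] A) Y]
    [ContinuousSMul (A ≃[L₀] A) Y] {y : Y}
    (hy : ∀ τ : Ordered A r ≃[withLT L₀] Ordered A r, reductAut r τ • y = y)
    {V : Set (Y × Y)} (hV : V ∈ 𝓤 Y) :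
    ∃ F : Finset A, ∀ g g' : A ≃[L₀] A,
      (∀ a ∈ F, ∀ b ∈ F, (g • r).1 a b = (g' • r).1 a b) → (g • y, g' • y) ∈ V := by
  classical
  obtain ⟨F, hF⟩ := mem_nhds_aut_iff.1
    (eventually_forall_smul_mem_uniformity (G := A ≃[L₀] A) hV)
  refine ⟨F, fun g g' h => ?_⟩
  let B := FirstOrder.Language.Substructure.closure L₀
    ((F.image fun a => g'⁻¹ a : Finset A) : Set A)
  have hB : ∀ a : A, a ∈ B ↔ g' a ∈ F := fun a => by
    rw [mem_closure_finset, Finset.mem_image]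
    constructor
    · rintro ⟨b, hb, rfl⟩
      rwa [aut_apply_inv_self]
    · exact fun ha => ⟨g' a, ha, aut_inv_apply_self g' a⟩
  have _ : Finite B := finite_closure_finset _
  obtain ⟨τ, hτ⟩ := hhom.exists_extension B ((g⁻¹ * g').toEmbedding.comp B.subtype) fun a b => by
    have := h _ ((hB a).1 a.2) _ ((hB b).1 b.2)
    rwa [lo_smul_apply, lo_smul_apply, aut_inv_apply_self, aut_inv_apply_self] at this
  have hfix := hF (g * reductAut r τ * g'⁻¹) (fun a ha => ?_) (g' • y)
  · simpa [mul_smul, hy] using hfix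
  · have hτa := hτ ⟨g'⁻¹ a, (hB _).2 (by rwa [aut_apply_inv_self])⟩
    change g (reductAut r τ (g'⁻¹ a)) = a
    rw [show reductAut r τ (g'⁻¹ a) = g⁻¹ (g' (g'⁻¹ a)) from hτa, aut_apply_inv_self,
      aut_apply_inv_self]

/-- Each ordering in the closure of the orbit of `r` has `r` in the closure of its orbit. -/
theorem FinitelyHomogeneous.mem_closure_orbit
    (hhom : FinitelyHomogeneous (withLT L₀) (Ordered A r))
    (hO : OrderingProperty ((withLT L₀).age (Ordered A r)))
    {G : Subgroup (A ≃[L₀] A)} (hG : Dense (G : Set (A ≃[L₀] A)))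
    {p : LO A} (hp : p ∈ closure (MulAction.orbit G r)) : r ∈ closure (MulAction.orbit G p) := by
  refine mem_closure_iff_nhds.2 fun s hs => ?_
  obtain ⟨F, hF⟩ := mem_nhds_lo_iff.1 hs
  let B := FirstOrder.Language.Substructure.closure L₀ (F : Set A)
  have _ : Finite B := finite_closure_finset F
  let rB : LO B := r.comap B.subtype.toEmbedding
  have hrB : ContainsOrdered ((withLT L₀).age (Ordered A r)) B rB :=
    ⟨haveI : Finite (Ordered B rB) := ‹Finite B›;
      FirstOrder.Language.Structure.FG.of_finite,
      ⟨orderedEmbedding B.subtype fun _ _ => rfl⟩⟩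
  -- `C` is a finite structure all of whose admissible orderings contain a copy of `(B, rB)`.
  obtain ⟨⟨C, _⟩, ⟨t, htfg, ⟨ι⟩⟩, hC⟩ := hO ⟨B, inferInstance⟩ ⟨rB, hrB⟩
  have hCfin : Finite C := htfg.finite
  let e : C ↪[L₀] A := reductEmbedding ι
  let I : Finset A := (Set.finite_range e).toFinset
  have hI : ∀ c, e c ∈ I := fun c => (Set.finite_range e).mem_toFinset.2 ⟨c, rfl⟩
  obtain ⟨_, hg, ⟨g, rfl⟩⟩ := mem_closure_iff_nhds.1 hp
    {q | ∀ a ∈ I, ∀ b ∈ I, q.1 a b = p.1 a b} (mem_nhds_lo_iff.2 ⟨I, fun _ => id⟩)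
  let g₀ : A ≃[L₀] A := g
  have hg₀ : ∀ c d, r.1 (g₀⁻¹ (e c)) (g₀⁻¹ (e d)) = p.1 (e c) (e d) := fun c d =>
    hg _ (hI c) _ (hI d)
  let t' : LO C := p.comap e.toEmbedding
  -- The ordering that `p` induces on `C` is admissible: on the image of `C`, `p` agrees with some
  -- `g • r`, so `g⁻¹` embeds `C` with this ordering into `(A, r)`.
  obtain ⟨j⟩ := hC rB t' hrB
    ⟨haveI : Finite (Ordered C t') := hCfin;
      FirstOrder.Language.Structure.FG.of_finite,
      ⟨orderedEmbedding ((g₀⁻¹).toEmbedding.comp e) hg₀⟩⟩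
  let j₀ : B ↪[L₀] C := reductEmbedding j
  have hj : ∀ a b : B, p.1 (e (j₀ a)) (e (j₀ b)) = r.1 a b := lo_map j
  obtain ⟨τ, hτ⟩ := hhom.exists_extension B (((g₀⁻¹).toEmbedding.comp e).comp j₀)
    fun a b => (hg₀ _ _).trans (hj a b)
  -- `g₀ * τ` carries `B` onto a copy on which `p` looks like `r`. Density replaces it by an element
  -- `k` of `G` with the same values on `F`, so `k⁻¹ • p` agrees with `r` there.
  obtain ⟨k, hk⟩ := exists_mem_eqOn_of_dense hG (g₀ * reductAut r τ) F
  have hk' : ∀ a : B, (k : A ≃[L₀] A) a = e (j₀ a) := fun a => by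
    rw [hk a ((mem_closure_finset F _).1 a.2)]
    change g₀ (reductAut r τ a) = _
    rw [hτ a]
    exact aut_apply_inv_self g₀ _
  refine ⟨k⁻¹ • p, hF _ fun a ha b hb => ?_, ⟨k⁻¹, rfl⟩⟩
  have ha' := (mem_closure_finset (L₀ := L₀) F a).2 ha
  have hb' := (mem_closure_finset (L₀ := L₀) F b).2 hb
  have := hj ⟨a, ha'⟩ ⟨b, hb'⟩
  rw [← hk', ← hk'] at this
  exact this

theorem isMinimalFlow_orbitClosure
    (hhom : FinitelyHomogeneous (withLT L₀) (Ordered A r))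
    (hO : OrderingProperty ((withLT L₀).age (Ordered A r)))
    {G : Subgroup (A ≃[L₀] A)} (hG : Dense (G : Set (A ≃[L₀] A))) :
    IsMinimalFlow G (orbitClosure G r) where
  compact := isCompact_iff_compactSpace.1
    (show IsClosed (closure (MulAction.orbit G r)) from isClosed_closure).isCompact
  hausdorff := inferInstance
  nonempty := ⟨⟨r, subset_closure (MulAction.mem_orbit_self r)⟩⟩
  continuous_action := ⟨by
    refine Continuous.subtype_mk ?_ _
    exact (continuous_smul (M := A ≃[L₀] A) (X := LO A)).comp
      ((continuous_subtype_val.comp continuous_fst).prodMk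
        (continuous_subtype_val.comp continuous_snd))⟩
  minimal := ⟨fun p q => by
    have himage : Subtype.val '' MulAction.orbit G p = MulAction.orbit G (p : LO A) := by
      rw [MulAction.orbit, MulAction.orbit, ← Set.range_comp]
      rfl
    rw [closure_subtype, himage]
    -- It suffices to recover `r`: a closed invariant set containing `r` contains the closure of its
    -- orbit.
    have hr := hhom.mem_closure_orbit hO hG p.2
    refine closure_minimal ?_ isClosed_closure q.2
    rintro _ ⟨g, rfl⟩
    exact smul_closure_orbit_subset g _ (Set.smul_mem_smul_set hr)⟩

/-- An `Aut(A)`-flow restricts along `reductAut r` to a flow of `Aut(A, r)`, which has a fixed point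
by the Ramsey property. -/
theorem exists_reductAut_fixedPoint
    (hhom : FinitelyHomogeneous (withLT L₀) (Ordered A r))
    (hR : RamseyProperty ((withLT L₀).age (Ordered A r)))
    (Y : Type z) [TopologicalSpace Y] [CompactSpace Y] [T2Space Y] [Nonempty Y]
    [MulAction (A ≃[L₀] A) Y] [ContinuousSMul (A ≃[L₀] A) Y] :
    ∃ y : Y, ∀ τ : Ordered A r ≃[withLT L₀] Ordered A r, reductAut r τ • y = y := by
  let _ : MulAction (Ordered A r ≃[withLT L₀] Ordered A r) Y :=
    MulAction.compHom Y (reductAut r)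
  have _ : ContinuousSMul (Ordered A r ≃[withLT L₀] Ordered A r) Y :=
    ⟨(continuous_smul (M := A ≃[L₀] A) (X := Y)).comp
      ((continuous_reductAut r).prodMap continuous_id)⟩
  exact hhom.exists_fixedPoint (finitelyRigid_ordered r) hR Y

theorem exists_surjective_orbitClosure
    (hhom : FinitelyHomogeneous (withLT L₀) (Ordered A r))
    (hR : RamseyProperty ((withLT L₀).age (Ordered A r)))
    {G : Subgroup (A ≃[L₀] A)} (hG : Dense (G : Set (A ≃[L₀] A)))
    (Y : Type z) [TopologicalSpace Y] [MulAction G Y] (hY : IsMinimalFlow G Y) :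
    ∃ f : orbitClosure G r → Y, Continuous f ∧ Function.Surjective f ∧
      ∀ (g : G) (p : orbitClosure G r), f (g • p) = g • f p := by
  have := hY.compact
  have := hY.hausdorff
  have := hY.nonempty
  have := hY.continuous_action
  have := hY.minimal
  let _ : UniformSpace Y := uniformSpaceOfCompactR1
  obtain ⟨y, hy⟩ : ∃ y : Y, ∀ V ∈ 𝓤 Y, ∃ F : Finset A, ∀ g g' : G,
      (∀ a ∈ F, ∀ b ∈ F, (g • r).1 a b = (g' • r).1 a b) → (g • y, g' • y) ∈ V := by
    obtain ⟨_, _, hext⟩ := exists_flow_extension G.subtype IsInducing.subtypeVal hG.denseRange_val Y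
    obtain ⟨y, hy⟩ := exists_reductAut_fixedPoint hhom hR Y
    refine ⟨y, fun V hV => ?_⟩
    obtain ⟨F, hF⟩ := hhom.exists_forall_smul_near hy hV
    refine ⟨F, fun g g' h => ?_⟩
    have := hF g g' h
    rwa [show (g : A ≃[L₀] A) • y = _ from hext g y,
      show (g' : A ≃[L₀] A) • y = _ from hext g' y] at this
  refine exists_surjective_of_orbitClosure r y fun q V hV => ?_
  obtain ⟨F, hF⟩ := hy V hV
  refine ⟨{q' | ∀ a ∈ F, ∀ b ∈ F, q'.1 a b = q.1 a b}, mem_nhds_lo_iff.2 ⟨F, fun _ => id⟩,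
    fun g g' h h' => hF g g' fun a ha b hb => (h a ha b hb).trans (h' a ha b hb).symm⟩

theorem extremelyAmenable_of_dense
    (hhom : FinitelyHomogeneous (withLT L₀) (Ordered A r))
    (hR : RamseyProperty ((withLT L₀).age (Ordered A r)))
    {G : Subgroup (Ordered A r ≃[withLT L₀] Ordered A r)}
    (hG : Dense (G : Set (Ordered A r ≃[withLT L₀] Ordered A r))) :
    ExtremelyAmenable.{w, z} G := by
  refine extremelyAmenable_of_exists_fixedPoint fun Y _ _ hY => ?_
  have := hY.compact
  have := hY.hausdorff
  have := hY.nonempty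
  have := hY.continuous_action
  obtain ⟨_, _, hext⟩ := exists_flow_extension G.subtype IsInducing.subtypeVal hG.denseRange_val Y
  obtain ⟨y, hy⟩ := hhom.exists_fixedPoint (finitelyRigid_ordered r) hR Y
  exact ⟨y, fun g => (hext g y).symm.trans (hy g)⟩

end OrderFlow

end JonssonFlows

theorem mainTheorem4
    (L₀ : FirstOrder.Language.{u, v}) [L₀.IsRelational]
    (α : Ordinal.{w}) (hα : 0 < α) (hpow : ℵ_ α ^< ℵ_ α = ℵ_ α)
    (K : Set (Bundled.{w} (withLT L₀).Structure))
    (hord : IsOrderedClass K)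
    (hJ : IsJonssonClass α K)
    (hreas : IsReasonable K)
    (hsub : ClosedUnderSubstructures K)
    (A : Type w) [L₀.Structure A] (r : LO A)
    (huniv : IsUniversal α K (Ordered A r))
    (hhom : IsHomogeneous α K (Ordered A r)) :
    (RamseyProperty ((withLT L₀).age (Ordered A r)) →
      ∀ G : Subgroup (Ordered A r ≃[withLT L₀] Ordered A r),
        Dense (G : Set (Ordered A r ≃[withLT L₀] Ordered A r)) →
          ExtremelyAmenable.{w, z} G) ∧
    (RamseyProperty ((withLT L₀).age (Ordered A r)) →
      OrderingProperty ((withLT L₀).age (Ordered A r)) →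
      ∀ G : Subgroup (A ≃[L₀] A), Dense (G : Set (A ≃[L₀] A)) →
        IsUniversalMinimalFlow.{w, w, z} G (orbitClosure G r)) := by
  have hfin := finitelyHomogeneous_of_isHomogeneous hsub hhom
  exact ⟨fun hR _ hG => extremelyAmenable_of_dense hfin hR hG,
    fun hR hO _ hG => ⟨isMinimalFlow_orbitClosure hfin hO hG,
      fun Y _ _ hY => exists_surjective_orbitClosure hfin hR hG Y hY⟩⟩
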